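/- For an integer $k\ge 0$, let $\mathbf{k}$ denote the chain with $k$ elements, let $\mathbf m\times\mathbf n$ carry the componentwise order, and let $P\oplus Q$ denote the ordinal sum of posets $P$ and $Q$ (the disjoint union, in which every element of $P$ lies below every element of $Q$). The incomparability graph $\mathrm{inc}(P)$ of a finite poset $P$ has vertex set $P$, two elements being adjacent when they are incomparable. A stable partition of a finite graph is a partition of its vertex set into parts that contain no two adjacent vertices; its type is the integer partition formed by the sizes of the parts, in weakly decreasing order. For partitions $\mu,\nu$ of the same integer, write $\mu\unlhd\nu$ if $\sum_{i=1}^k\mu_i\le\sum_{i=1}^k\nu_i$ for all $k\ge 1$ (missing parts count as $0$). A graph $G$ is nice if, whenever $G$ has a stable partition of type $\nu$, it has a stable partition of type $\mu$ for every $\mu\unlhd\nu$. A finite poset $P$ is nice if $\mathrm{inc}(P)$ is nice. **Theorem.** For all integers $p,q\ge 0$ and $m,n\ge 1$, the poset $\mathbf p\oplus(\mathbf m\times\mathbf n)\oplus\mathbf q$ is a distributive lattice and is nice. -/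

import Mathlib

/-- The incomparability graph of a poset: the vertices are the elements, and two elements are
adjacent when they are incomparable. -/
def incGraph (P : Type*) [PartialOrder P] : SimpleGraph P where
  Adj a b := IncompRel (· ≤ ·) a b
  symm := ⟨fun _ _ h => ⟨h.2, h.1⟩⟩
  loopless := ⟨fun a h => h.1 (le_refl a)⟩

/-- The sum of the `k` largest parts of a partition (of all the parts if there are fewer). -/
def Nat.Partition.sumLargest {n : ℕ} (μ : n.Partition) (k : ℕ) : ℕ :=
  ((μ.parts.sort (· ≥ ·)).take k).sum

/-- The dominance order `μ ⊴ ν` on partitions of `n`. -/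
def Nat.Partition.DominatedBy {n : ℕ} (μ ν : n.Partition) : Prop :=
  ∀ k : ℕ, 1 ≤ k → μ.sumLargest k ≤ ν.sumLargest k

/-- The type of a set partition of a finite set: the partition formed by the sizes of its parts. -/
def Finpartition.sizeType {V : Type*} [Fintype V] [DecidableEq V]
    (π : Finpartition (Finset.univ : Finset V)) : (Fintype.card V).Partition where
  parts := π.parts.val.map Finset.card
  parts_pos := by
    intro i hi
    obtain ⟨s, hs, rfl⟩ := Multiset.mem_map.1 hi
    exact (π.nonempty_of_mem_parts hs).card_pos
  parts_sum := π.sum_card_parts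

/-- `G` has a stable partition of type `μ`: a partition of its vertex set into parts without
adjacent vertices, whose sizes form the partition `μ`. -/
def SimpleGraph.HasStablePartition {V : Type*} [Fintype V] [DecidableEq V] (G : SimpleGraph V)
    (μ : (Fintype.card V).Partition) : Prop :=
  ∃ π : Finpartition (Finset.univ : Finset V),
    (∀ s ∈ π.parts, ∀ a ∈ s, ∀ b ∈ s, ¬ G.Adj a b) ∧ π.sizeType = μ

/-- A graph is nice if the types of its stable partitions are closed downwards in dominance
order. -/
def SimpleGraph.IsNice {V : Type*} [Fintype V] [DecidableEq V] (G : SimpleGraph V) : Prop :=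
  ∀ ν : (Fintype.card V).Partition, G.HasStablePartition ν →
    ∀ μ : (Fintype.card V).Partition, μ.DominatedBy ν → G.HasStablePartition μ

/-- A poset is nice if its incomparability graph is. -/
def IsNicePoset (P : Type*) [PartialOrder P] [Fintype P] [DecidableEq P] : Prop :=
  (incGraph P).IsNice

/-- The given partial order on `P` is the order of a distributive lattice. -/
def IsDistribLatticeOrder (P : Type*) [inst : PartialOrder P] : Prop :=
  ∃ L : DistribLattice P, L.toLattice.toSemilatticeSup.toPartialOrder = inst

/-- The poset `p ⊕ (m × n) ⊕ q`: `Fin k` is the chain with `k` elements, the product carries the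
componentwise order, and `⊕ₗ` is the ordinal sum, in which every element of the left summand lies
below every element of the right summand. -/
abbrev ChainProdSum (p m n q : ℕ) : Type :=
  (Fin p ⊕ₗ (Fin m × Fin n)) ⊕ₗ Fin q

/-! Stable sets of the incomparability graph are chains. Draw the poset in `ℕ × ℕ` so that each
level `i + j = ρ` is an interval `lo ρ ≤ i < hi ρ` of size `h ρ`. A chain meets a level at most
once, so `k` disjoint chains cover at most `∑ min k (h ρ)` elements. These bounds pass to dominated
partitions, so it suffices that every `μ` satisfying them is realised (`IsBand.hasStablePartition`).

A chain partition is encoded by an array `Z` whose row `ρ` climbs from `lo ρ` to `hi ρ` in steps of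
`0` or `1`: the element of level `ρ` with first coordinate `i` goes to the chain `c` at which row
`ρ` steps from `i` to `i + 1`. Column sums of `Z` record the sizes of unions of initial chains. The
array `min (lo ρ + c) (hi ρ)` attains all the bounds, and `IsHeight.exists_sum_eq` lowers its
entries one at a time until the column sums are those prescribed by `μ`, which are concave because
the parts decrease. -/

/-! ### Height functions and the lowering of their column sums. -/

/-- An array of natural numbers whose first `N` rows are height functions: neighbouring entries
in a row or in a column increase by `0` or `1`. -/
structure IsHeight (N : ℕ) (Z : ℕ → ℕ → ℕ) : Prop where
  le_col : ∀ ρ c, Z ρ c ≤ Z ρ (c + 1)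
  col_le : ∀ ρ c, Z ρ (c + 1) ≤ Z ρ c + 1
  le_row : ∀ ρ c, ρ + 1 < N → Z ρ c ≤ Z (ρ + 1) c
  row_le : ∀ ρ c, ρ + 1 < N → Z (ρ + 1) c ≤ Z ρ c + 1

namespace IsHeight

variable {N : ℕ} {Z : ℕ → ℕ → ℕ}

/-- The array `Z` with the entry at `(ρ, c)` decreased by one. -/
def lower (Z : ℕ → ℕ → ℕ) (ρ c : ℕ) : ℕ → ℕ → ℕ :=
  fun ρ' c' => if ρ' = ρ ∧ c' = c then Z ρ' c' - 1 else Z ρ' c'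

theorem lower_le (Z : ℕ → ℕ → ℕ) (ρ c ρ' c' : ℕ) : lower Z ρ c ρ' c' ≤ Z ρ' c' := by
  unfold lower; split_ifs <;> omega

theorem lower_of_ne (Z : ℕ → ℕ → ℕ) (ρ : ℕ) {c c' : ℕ} (h : c' ≠ c) (ρ' : ℕ) :
    lower Z ρ c ρ' c' = Z ρ' c' := by
  simp [lower, h]

theorem sum_lower {ρ c : ℕ} (hρ : ρ < N) (h : 0 < Z ρ c) :
    ∑ i ∈ Finset.range N, lower Z ρ c i c + 1 = ∑ i ∈ Finset.range N, Z i c := by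
  rw [← Finset.add_sum_erase _ _ (Finset.mem_range.2 hρ),
    ← Finset.add_sum_erase _ (fun i => Z i c) (Finset.mem_range.2 hρ)]
  have : ∑ i ∈ (Finset.range N).erase ρ, lower Z ρ c i c
      = ∑ i ∈ (Finset.range N).erase ρ, Z i c :=
    Finset.sum_congr rfl fun i hi => by simp [lower, (Finset.mem_erase.1 hi).1]
  rw [this]
  simp only [lower, and_self, if_true]
  omega

/-- If column `c + 1` can be lowered somewhere without regard to the columns, then it can be
lowered somewhere so that the array remains a height function. -/
theorem exists_lower (hZ : IsHeight N Z) (c : ℕ)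
    (h : ∃ ρ < N, Z ρ (c + 1) = Z ρ c + 1 ∧ Z ρ (c + 2) = Z ρ (c + 1)) :
    ∃ ρ < N, 0 < Z ρ (c + 1) ∧ IsHeight N (lower Z ρ (c + 1)) := by
  classical
  let D := (Finset.range N).filter
    fun ρ => Z ρ (c + 1) = Z ρ c + 1 ∧ Z ρ (c + 2) = Z ρ (c + 1)
  have hD : D.Nonempty := by
    obtain ⟨ρ, h1, h2⟩ := h
    exact ⟨ρ, by simp [D, h1, h2]⟩
  -- An adjacent row that blocks the lowering at `ρ` lies in `D` again and has a weight larger by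
  -- one: the next row if it is one higher, the previous row if it has the same height. A row of
  -- maximal weight is therefore unblocked.
  obtain ⟨ρ, hρ, hmax⟩ := D.exists_max_image (fun ρ => (2 * Z ρ (c + 1) : ℤ) - ρ) hD
  simp only [D, Finset.mem_filter, Finset.mem_range] at hρ hmax
  obtain ⟨hρN, h1, h2⟩ := hρ
  have up : ρ + 1 < N → Z (ρ + 1) (c + 1) = Z ρ (c + 1) := by
    intro hN
    by_contra hne
    have a1 := hZ.le_row ρ (c + 1) hN
    have a2 := hZ.row_le ρ (c + 1) hN
    have a3 := hZ.row_le ρ c hN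
    have a4 := hZ.row_le ρ (c + 2) hN
    have a5 := hZ.col_le (ρ + 1) c
    have a6 := hZ.le_col (ρ + 1) (c + 1)
    have := hmax (ρ + 1) ⟨hN, by omega, by rw [show c + 1 + 1 = c + 2 from rfl] at a6; omega⟩
    push_cast at this
    omega
  have down : ∀ σ, σ + 1 = ρ → Z σ (c + 1) + 1 = Z ρ (c + 1) := by
    rintro σ rfl
    by_contra hne
    have a1 := hZ.le_row σ (c + 1) hρN
    have a2 := hZ.row_le σ (c + 1) hρN
    have a3 := hZ.le_row σ c hρN
    have a4 := hZ.le_row σ (c + 2) hρN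
    have a5 := hZ.col_le σ c
    have a6 := hZ.le_col σ (c + 1)
    have := hmax σ ⟨by omega, by omega, by rw [show c + 1 + 1 = c + 2 from rfl] at a6; omega⟩
    push_cast at this
    omega
  refine ⟨ρ, hρN, by omega, ?_, ?_, ?_, ?_⟩
  · intro ρ' c'
    have := hZ.le_col ρ' c'
    unfold lower
    split_ifs with g1 g2 g2 <;> try omega
    obtain ⟨rfl, g⟩ := g2
    obtain rfl : c' = c := by omega
    omega
  · intro ρ' c'
    have := hZ.col_le ρ' c'
    unfold lower
    split_ifs with g1 g2 g2 <;> try omega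
    obtain ⟨rfl, rfl⟩ := g2
    have : Z ρ' (c + 1 + 1) = Z ρ' (c + 1) := h2
    omega
  · intro ρ' c' hN
    have := hZ.le_row ρ' c' hN
    unfold lower
    split_ifs with g1 g2 g2 <;> try omega
    obtain ⟨g, rfl⟩ := g2
    have := down ρ' g
    rw [g]
    omega
  · intro ρ' c' hN
    have := hZ.row_le ρ' c' hN
    unfold lower
    split_ifs with g1 g2 g2 <;> try omega
    obtain ⟨rfl, rfl⟩ := g2
    have := up hN
    omega

/-- The column sums of a height function can be lowered to any concave sequence below them. -/
theorem exists_sum_eq (hZ : IsHeight N Z) (M : ℕ) (T : ℕ → ℕ)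
    (hT : ∀ c, T c + T (c + 2) ≤ 2 * T (c + 1))
    (h0 : T 0 = ∑ ρ ∈ Finset.range N, Z ρ 0) (hM : T M = ∑ ρ ∈ Finset.range N, Z ρ M)
    (hle : ∀ c ≤ M, T c ≤ ∑ ρ ∈ Finset.range N, Z ρ c) :
    ∃ Z', IsHeight N Z' ∧ (∀ ρ c, Z' ρ c ≤ Z ρ c) ∧ (∀ ρ, Z' ρ 0 = Z ρ 0) ∧
      ∀ c ≤ M, ∑ ρ ∈ Finset.range N, Z' ρ c = T c := by
  classical
  induction hS : ∑ c ∈ Finset.range (M + 1), ∑ ρ ∈ Finset.range N, Z ρ c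
    using Nat.strong_induction_on generalizing Z with
  | _ S ih =>
  subst hS
  set A : ℕ → ℕ := fun c => ∑ ρ ∈ Finset.range N, Z ρ c with hA
  by_cases hall : ∀ c ≤ M, A c = T c
  · exact ⟨Z, hZ, fun _ _ => le_rfl, fun _ => rfl, hall⟩
  push Not at hall
  obtain ⟨b, hbM, hb⟩ := hall
  -- the last index at which the excess `A - T` is maximal
  obtain ⟨d, hd, hdmax⟩ := (Finset.range (M + 1)).exists_max_image
    (fun c => (M + 1) * (A c - T c) + c) ⟨0, by simp⟩
  simp only [Finset.mem_range] at hd hdmax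
  -- The tie-breaker `c ≤ M` cannot outweigh a unit of excess, which counts `M + 1`.
  have hexc : ∀ c ≤ M, A c - T c ≤ A d - T d := by
    intro c hc
    by_contra hlt
    have h1 := hdmax c (by omega)
    have h2 : (M + 1) * (A d - T d + 1) ≤ (M + 1) * (A c - T c) :=
      Nat.mul_le_mul_left _ (by omega)
    rw [mul_add] at h2
    omega
  have hexc' : ∀ c, d < c → c ≤ M → A c - T c < A d - T d := by
    intro c hdc hc
    refine lt_of_le_of_ne (hexc c hc) fun he => ?_
    have h1 := hdmax c (by omega)
    rw [he] at h1
    omega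
  have hAT : ∀ c ≤ M, T c ≤ A c := hle
  have hpos : 0 < A d - T d := by
    have := hexc b hbM
    have := hAT b hbM
    omega
  have hd0 : d ≠ 0 := by
    rintro rfl
    have : A 0 = T 0 := h0.symm
    omega
  have hdM : d ≠ M := by
    rintro rfl
    have : A d = T d := hM.symm
    omega
  obtain ⟨c, rfl⟩ := Nat.exists_eq_succ_of_ne_zero hd0
  rw [Nat.succ_eq_add_one] at *
  -- The excess does not rise from `c` to `c + 1` by less than `0` and drops strictly afterwards;
  -- with `T` concave, `A` is strictly concave here.
  have hdesc : A c + A (c + 2) < 2 * A (c + 1) := by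
    have e1 := hexc c (by omega)
    have e2 := hexc' (c + 2) (by omega) (by omega)
    have := hT c
    have := hAT c (by omega)
    have := hAT (c + 1) (by omega)
    have := hAT (c + 2) (by omega)
    omega
  -- If no row had a step followed by a non-step, every row would be convex at `c + 1`, and so would
  -- the sum `A`.
  have hex : ∃ ρ < N, Z ρ (c + 1) = Z ρ c + 1 ∧ Z ρ (c + 2) = Z ρ (c + 1) := by
    by_contra hno
    push Not at hno
    have : ∑ ρ ∈ Finset.range N, 2 * Z ρ (c + 1)
        ≤ ∑ ρ ∈ Finset.range N, (Z ρ c + Z ρ (c + 2)) := by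
      refine Finset.sum_le_sum fun ρ hρ => ?_
      have g := hno ρ (Finset.mem_range.1 hρ)
      have a1 := hZ.le_col ρ c
      have a2 := hZ.col_le ρ c
      have a3 : Z ρ (c + 1) ≤ Z ρ (c + 2) := hZ.le_col ρ (c + 1)
      have a4 : Z ρ (c + 2) ≤ Z ρ (c + 1) + 1 := hZ.col_le ρ (c + 1)
      omega
    rw [Finset.sum_add_distrib, ← Finset.mul_sum] at this
    simp only [hA] at hdesc
    omega
  obtain ⟨ρ, hρN, hρ, hlow⟩ := hZ.exists_lower c hex
  have hsum := sum_lower hρN hρ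
  have hne : ∀ c' ≠ c + 1, ∑ i ∈ Finset.range N, lower Z ρ (c + 1) i c' = A c' :=
    fun c' h => Finset.sum_congr rfl fun i _ => lower_of_ne Z ρ h i
  have hlt : ∑ j ∈ Finset.range (M + 1), ∑ i ∈ Finset.range N, lower Z ρ (c + 1) i j
      < ∑ j ∈ Finset.range (M + 1), A j :=
    Finset.sum_lt_sum (fun j _ => Finset.sum_le_sum fun i _ => lower_le ..)
      ⟨c + 1, Finset.mem_range.2 (by omega), Nat.lt_of_succ_le hsum.le⟩
  have hlow0 : T 0 = ∑ i ∈ Finset.range N, lower Z ρ (c + 1) i 0 := by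
    rw [hne 0 (by omega)]
    exact h0
  have hlowM : T M = ∑ i ∈ Finset.range N, lower Z ρ (c + 1) i M := by
    rw [hne M (by omega)]
    exact hM
  have hlowle : ∀ j ≤ M, T j ≤ ∑ i ∈ Finset.range N, lower Z ρ (c + 1) i j := fun j hj => by
    by_cases h : j = c + 1
    · subst h
      have : A (c + 1) = ∑ i ∈ Finset.range N, Z i (c + 1) := rfl
      omega
    · rw [hne j h]
      exact hAT j hj
  obtain ⟨Z', h1, h2, h3, h4⟩ := ih _ hlt hlow hlow0 hlowM hlowle rfl
  refine ⟨Z', h1, fun i j => (h2 i j).trans (lower_le ..), fun i => ?_, h4⟩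
  rw [h3, lower_of_ne Z ρ (by omega)]

theorem col_mono (hZ : IsHeight N Z) (ρ : ℕ) : Monotone (Z ρ) :=
  monotone_nat_of_le_succ (hZ.le_col ρ)

theorem row_add (hZ : IsHeight N Z) (c ρ k : ℕ) (h : ρ + k < N) :
    Z ρ c ≤ Z (ρ + k) c ∧ Z (ρ + k) c ≤ Z ρ c + k := by
  induction k with
  | zero => simp
  | succ k ih =>
    have := ih (by omega)
    have := hZ.le_row (ρ + k) c (by omega)
    have := hZ.row_le (ρ + k) c (by omega)
    rw [← add_assoc]
    omega

/-- In a row of a height function, each value is attained for the last time exactly once. -/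
theorem exists_step (hZ : IsHeight N Z) {ρ r M : ℕ} (h0 : Z ρ 0 ≤ r) (hM : r < Z ρ M) :
    ∃ c < M, Z ρ c = r ∧ Z ρ (c + 1) = r + 1 := by
  classical
  have hex : ∃ c, r < Z ρ c := ⟨M, hM⟩
  have h1 := Nat.find_spec hex
  have h2 := Nat.find_min' hex hM
  have h3 : Nat.find hex ≠ 0 := fun h => by rw [h] at h1; omega
  obtain ⟨c, hc⟩ := Nat.exists_eq_succ_of_ne_zero h3
  have h4 := Nat.find_min hex (m := c) (by omega)
  rw [hc, Nat.succ_eq_add_one] at h1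
  have := hZ.col_le ρ c
  exact ⟨c, by omega, by omega, by omega⟩

theorem step_unique (hZ : IsHeight N Z) {ρ r c c' : ℕ} (h : Z ρ c = r) (h1 : Z ρ (c + 1) = r + 1)
    (h' : Z ρ c' = r) (h1' : Z ρ (c' + 1) = r + 1) : c = c' := by
  rcases lt_trichotomy c c' with g | g | g
  · have := hZ.col_mono ρ (show c + 1 ≤ c' from g); omega
  · exact g
  · have := hZ.col_mono ρ (show c' + 1 ≤ c from g); omega

end IsHeight

/-! ### Bands in the plane, and sums of largest parts. -/

/-- An order embedding `f` of `P` into `ℕ × ℕ` whose image consists of the pairs `(i, j)` with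
`i + j < N` and `lo (i + j) ≤ i < hi (i + j)`, where `lo` and `hi` increase in steps of at
most one. -/
structure IsBand {P : Type*} [PartialOrder P] (f : P ↪o ℕ × ℕ) (N : ℕ) (lo hi : ℕ → ℕ) :
    Prop where
  lo_le : ∀ ρ, lo ρ ≤ lo (ρ + 1)
  le_lo : ∀ ρ, lo (ρ + 1) ≤ lo ρ + 1
  hi_le : ∀ ρ, hi ρ ≤ hi (ρ + 1)
  le_hi : ∀ ρ, hi (ρ + 1) ≤ hi ρ + 1
  lo_le_hi : ∀ ρ, lo ρ ≤ hi ρ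
  lt_N : ∀ x, (f x).1 + (f x).2 < N
  lo_le_fst : ∀ x, lo ((f x).1 + (f x).2) ≤ (f x).1
  fst_lt_hi : ∀ x, (f x).1 < hi ((f x).1 + (f x).2)
  exists_eq : ∀ ρ < N, ∀ i, lo ρ ≤ i → i < hi ρ → ∃ x, (f x).1 + (f x).2 = ρ ∧ (f x).1 = i

theorem List.sum_take_add_one_getD (l : List ℕ) (c : ℕ) :
    (l.take (c + 1)).sum = (l.take c).sum + l.getD c 0 := by
  induction l generalizing c with
  | nil => simp
  | cons a l ih =>
    cases c with
    | zero => simp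
    | succ c => simp [ih c, add_assoc]

theorem List.getD_add_one_le_of_pairwise {l : List ℕ} (hl : l.Pairwise (· ≥ ·)) (c : ℕ) :
    l.getD (c + 1) 0 ≤ l.getD c 0 := by
  by_cases h : c + 1 < l.length
  · rw [List.getD_eq_getElem _ _ h, List.getD_eq_getElem _ _ (by omega)]
    exact List.pairwise_iff_getElem.1 hl c (c + 1) _ h (by omega)
  · rw [List.getD_eq_default _ _ (by omega)]
    exact Nat.zero_le _

/-- A bound on the total size of any `k` parts bounds the sum of the `k` largest sizes. -/
theorem Finpartition.sumLargest_sizeType_le {V : Type*} [Fintype V] [DecidableEq V]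
    (π : Finpartition (Finset.univ : Finset V)) {k B : ℕ}
    (h : ∀ T ⊆ π.parts, T.card ≤ k → ∑ s ∈ T, s.card ≤ B) : π.sizeType.sumLargest k ≤ B := by
  classical
  have hp : (π.sizeType.parts.sort (· ≥ ·)).Perm (π.parts.toList.map Finset.card) := by
    rw [← Multiset.coe_eq_coe, Multiset.sort_eq, ← Multiset.map_coe, Finset.coe_toList]
    rfl
  -- The `k` largest sizes are, up to order, the sizes along a sublist of the parts, hence of at
  -- most `k` distinct parts.
  have hs : ((π.sizeType.parts.sort (· ≥ ·)).take k).Subperm (π.parts.toList.map Finset.card) :=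
    (List.take_sublist _ _).subperm.trans hp.subperm
  obtain ⟨l₂, hl₂, hsub⟩ := hs
  obtain ⟨l₁, hl₁, rfl⟩ := List.sublist_map_iff.1 hsub
  have hnd : l₁.Nodup := hl₁.nodup π.parts.nodup_toList
  have hlen : l₁.length ≤ k := by
    have := hl₂.length_eq
    rw [List.length_map] at this
    rw [this]
    exact List.length_take_le _ _
  have := h l₁.toFinset (fun s hs => by simpa using hl₁.subset (List.mem_toFinset.1 hs))
    ((List.toFinset_card_le _).trans hlen)
  rw [List.sum_toFinset _ hnd, hl₂.sum_eq] at this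
  exact this

/-! ### Chain partitions of a band. -/

namespace IsBand

variable {P : Type*} [PartialOrder P] {f : P ↪o ℕ × ℕ} {N : ℕ} {lo hi : ℕ → ℕ}

theorem ext_iff (f : P ↪o ℕ × ℕ) {x y : P} (h : (f x).1 + (f x).2 = (f y).1 + (f y).2)
    (h1 : (f x).1 = (f y).1) : x = y :=
  f.injective (Prod.ext h1 (by omega))

theorem level_lt (f : P ↪o ℕ × ℕ) {x y : P} (h : x < y) :
    (f x).1 + (f x).2 < (f y).1 + (f y).2 := by
  have h1 := f.strictMono h
  have h2 : (f x).1 ≤ (f y).1 ∧ (f x).2 ≤ (f y).2 := h1.le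
  by_contra h3
  exact h1.ne (Prod.ext (by omega) (by omega))

/-- The extremal array: its first `c` columns use up `min c (hi ρ - lo ρ)` elements of level `ρ`, as
many as `c` chains can. -/
theorem isHeight (hf : IsBand f N lo hi) : IsHeight N fun ρ c => min (lo ρ + c) (hi ρ) where
  le_col ρ c := by omega
  col_le ρ c := by omega
  le_row ρ c _ := by have := hf.lo_le ρ; have := hf.hi_le ρ; omega
  row_le ρ c _ := by have := hf.le_lo ρ; have := hf.le_hi ρ; omega

variable [Fintype P]

theorem card_level (hf : IsBand f N lo hi) {ρ : ℕ} (hρ : ρ < N) :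
    (Finset.univ.filter fun x => (f x).1 + (f x).2 = ρ).card = hi ρ - lo ρ := by
  rw [← Nat.card_Ico]
  refine Finset.card_nbij (fun x => (f x).1) ?_ ?_ ?_
  · intro x hx
    obtain rfl := (Finset.mem_filter.1 hx).2
    exact Finset.mem_coe.2 (Finset.mem_Ico.2 ⟨hf.lo_le_fst x, hf.fst_lt_hi x⟩)
  · intro x hx y hy hxy
    rw [Finset.mem_coe, Finset.mem_filter] at hx hy
    exact ext_iff f (hx.2.trans hy.2.symm) hxy
  · intro i hi'
    rw [Finset.mem_coe, Finset.mem_Ico] at hi'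
    obtain ⟨x, h1, h2⟩ := hf.exists_eq ρ hρ i hi'.1 hi'.2
    exact ⟨x, by simpa using h1, h2⟩

theorem card_eq (hf : IsBand f N lo hi) :
    Fintype.card P = ∑ ρ ∈ Finset.range N, (hi ρ - lo ρ) := by
  rw [← Finset.card_univ, Finset.card_eq_sum_card_fiberwise
    (f := fun x => (f x).1 + (f x).2) (t := Finset.range N)
    (fun x _ => Finset.mem_coe.2 (Finset.mem_range.2 (hf.lt_N x)))]
  exact Finset.sum_congr rfl fun ρ hρ => hf.card_level (Finset.mem_range.1 hρ)

/-- At most `∑ min k h` elements are covered by `k` chains, where `h` runs over the sizes of the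
levels. -/
theorem sumLargest_le [DecidableEq P] (hf : IsBand f N lo hi) {ν : (Fintype.card P).Partition}
    (hν : (incGraph P).HasStablePartition ν) (k : ℕ) :
    ν.sumLargest k ≤ ∑ ρ ∈ Finset.range N, min k (hi ρ - lo ρ) := by
  obtain ⟨π, hπ, rfl⟩ := hν
  refine π.sumLargest_sizeType_le fun T hT hk => ?_
  have h1 : ∀ s ∈ T, s.card = ∑ ρ ∈ Finset.range N,
      (s.filter fun x => (f x).1 + (f x).2 = ρ).card := fun s _ =>
    Finset.card_eq_sum_card_fiberwise fun x _ => Finset.mem_coe.2 (Finset.mem_range.2 (hf.lt_N x))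
  rw [Finset.sum_congr rfl h1, Finset.sum_comm]
  refine Finset.sum_le_sum fun ρ hρ => le_min ?_ ?_
  -- Distinct elements of one level are incomparable, so each chain contributes at most one.
  · refine (Finset.sum_le_card_nsmul T _ 1 fun s hs => ?_).trans (by simpa using hk)
    refine Finset.card_le_one.2 fun a ha b hb => ?_
    rw [Finset.mem_filter] at ha hb
    by_contra hab
    refine hπ s (hT hs) a ha.1 b hb.1 ⟨fun h => ?_, fun h => ?_⟩
    · have := level_lt f (lt_of_le_of_ne h hab)
      omega
    · have := level_lt f (lt_of_le_of_ne h (Ne.symm hab))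
      omega
  · rw [← hf.card_level (Finset.mem_range.1 hρ), ← Finset.card_biUnion]
    · refine Finset.card_le_card fun x hx => ?_
      obtain ⟨s, -, hs⟩ := Finset.mem_biUnion.1 hx
      simpa using (Finset.mem_filter.1 hs).2
    · intro s hs t ht hst
      exact (π.disjoint (hT hs) (hT ht) hst).mono (Finset.filter_subset _ _)
        (Finset.filter_subset _ _)

/-- The elements of `P` at which the height function `Z` makes its step in column `c`. -/
def strand (f : P ↪o ℕ × ℕ) (Z : ℕ → ℕ → ℕ) (c : ℕ) : Finset P :=
  Finset.univ.filter fun x => Z ((f x).1 + (f x).2) c = (f x).1 ∧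
    Z ((f x).1 + (f x).2) (c + 1) = (f x).1 + 1

theorem mem_strand {Z : ℕ → ℕ → ℕ} {c : ℕ} {x : P} : x ∈ strand f Z c ↔
    Z ((f x).1 + (f x).2) c = (f x).1 ∧ Z ((f x).1 + (f x).2) (c + 1) = (f x).1 + 1 := by
  simp [strand]

/-- Over `k` levels the first coordinate, read off from column `c`, grows by at least `0` and at
most `k`, so the second coordinate does not decrease either. -/
theorem strand_comparable (hf : IsBand f N lo hi) {Z : ℕ → ℕ → ℕ} (hZ : IsHeight N Z) {c : ℕ}
    {x y : P} (hx : x ∈ strand f Z c) (hy : y ∈ strand f Z c)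
    (hxy : (f x).1 + (f x).2 ≤ (f y).1 + (f y).2) : x ≤ y := by
  have h1 := (mem_strand.1 hx).1
  have h2 := (mem_strand.1 hy).1
  obtain ⟨k, hk⟩ := Nat.exists_eq_add_of_le hxy
  have hN := hf.lt_N y
  have := hZ.row_add c _ k (hk ▸ hN)
  rw [← hk] at this
  refine f.le_iff_le.1 (Prod.mk_le_mk.2 ⟨?_, ?_⟩ : ((f x).1, (f x).2) ≤ ((f y).1, (f y).2)) <;>
    omega

/-- The strand has one element in each level whose row steps at `c`: the bounds `lo ρ ≤ Z ρ c < hi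
ρ` place that element in the band. -/
theorem card_strand (hf : IsBand f N lo hi) {Z : ℕ → ℕ → ℕ} (hZ : IsHeight N Z)
    (h0 : ∀ ρ, Z ρ 0 = lo ρ) (hhi : ∀ ρ c, Z ρ c ≤ hi ρ) (c : ℕ) :
    (strand f Z c).card + ∑ ρ ∈ Finset.range N, Z ρ c = ∑ ρ ∈ Finset.range N, Z ρ (c + 1) := by
  have h : (strand f Z c).card
      = ((Finset.range N).filter fun ρ => Z ρ (c + 1) = Z ρ c + 1).card := by
    refine Finset.card_nbij (fun x => (f x).1 + (f x).2) ?_ ?_ ?_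
    · intro x hx
      have := mem_strand.1 hx
      have := hf.lt_N x
      simp only [Finset.coe_filter, Finset.mem_range, Set.mem_ofPred_eq]
      omega
    · intro x hx y hy hxy
      have h1 := (mem_strand.1 hx).1
      have h2 := (mem_strand.1 hy).1
      dsimp only at hxy
      rw [hxy] at h1
      exact ext_iff f hxy (h1.symm.trans h2)
    · intro ρ hρ
      simp only [Finset.coe_filter, Finset.mem_range, Set.mem_ofPred_eq] at hρ
      have h1 := hZ.col_mono ρ (Nat.zero_le c)
      rw [h0] at h1
      have h2 := hhi ρ (c + 1)
      obtain ⟨x, h3, h4⟩ := hf.exists_eq ρ hρ.1 (Z ρ c) h1 (by omega)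
      refine ⟨x, mem_strand.2 ?_, h3⟩
      rw [h3, h4]
      exact ⟨rfl, hρ.2⟩
  rw [h, Finset.card_filter, ← Finset.sum_add_distrib]
  refine Finset.sum_congr rfl fun ρ _ => ?_
  have := hZ.le_col ρ c
  have := hZ.col_le ρ c
  split_ifs <;> omega

/-- Every partition that satisfies the bounds on unions of chains is the type of a partition into
chains. -/
theorem hasStablePartition [DecidableEq P] (hf : IsBand f N lo hi) (μ : (Fintype.card P).Partition)
    (hμ : ∀ k, 1 ≤ k → μ.sumLargest k ≤ ∑ ρ ∈ Finset.range N, min k (hi ρ - lo ρ)) :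
    (incGraph P).HasStablePartition μ := by
  classical
  set l := μ.parts.sort (· ≥ ·) with hl
  have hlc : (l : Multiset ℕ) = μ.parts := Multiset.sort_eq _ _
  have hlsum : l.sum = Fintype.card P := by
    rw [← Multiset.sum_coe, hlc, μ.parts_sum]
  have hlsort : l.Pairwise (· ≥ ·) := Multiset.pairwise_sort _ _
  have hsucc : ∀ c, μ.sumLargest (c + 1) = μ.sumLargest c + l.getD c 0 :=
    fun c => l.sum_take_add_one_getD c
  have hzero : μ.sumLargest 0 = 0 := by simp [Nat.Partition.sumLargest]
  have htot : μ.sumLargest l.length = ∑ ρ ∈ Finset.range N, (hi ρ - lo ρ) := by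
    refine Eq.trans ?_ (hlsum.trans hf.card_eq)
    simp [Nat.Partition.sumLargest, ← hl]
  have hle : ∀ k, μ.sumLargest k ≤ ∑ ρ ∈ Finset.range N, min k (hi ρ - lo ρ) := fun k => by
    rcases Nat.eq_zero_or_pos k with rfl | hk
    · simp [hzero]
    · exact hμ k hk
  have hstart : ∀ c, ∑ ρ ∈ Finset.range N, min (lo ρ + c) (hi ρ)
      = ∑ ρ ∈ Finset.range N, lo ρ + ∑ ρ ∈ Finset.range N, min c (hi ρ - lo ρ) := fun c => by
    rw [← Finset.sum_add_distrib]
    refine Finset.sum_congr rfl fun ρ _ => ?_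
    have := hf.lo_le_hi ρ
    omega
  have hhisum : ∑ ρ ∈ Finset.range N, hi ρ
      = ∑ ρ ∈ Finset.range N, lo ρ + ∑ ρ ∈ Finset.range N, (hi ρ - lo ρ) := by
    rw [← Finset.sum_add_distrib]
    refine Finset.sum_congr rfl fun ρ _ => ?_
    have := hf.lo_le_hi ρ
    omega
  -- Consecutive differences are the parts in decreasing order, followed by the default value `0`,
  -- so concavity persists beyond the last part.
  have hconc : ∀ c, (∑ ρ ∈ Finset.range N, lo ρ + μ.sumLargest c) +
      (∑ ρ ∈ Finset.range N, lo ρ + μ.sumLargest (c + 2)) ≤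
      2 * (∑ ρ ∈ Finset.range N, lo ρ + μ.sumLargest (c + 1)) := fun c => by
    have h1 := hsucc c
    have h2 : μ.sumLargest (c + 2) = _ := hsucc (c + 1)
    have h3 := List.getD_add_one_le_of_pairwise hlsort c
    omega
  obtain ⟨Z, hZ, hZle, hZ0, hZsum⟩ := hf.isHeight.exists_sum_eq l.length
    (fun c => ∑ ρ ∈ Finset.range N, lo ρ + μ.sumLargest c) hconc
    (by rw [hstart]; simp [hzero])
    (by
      rw [hstart]
      refine congrArg _ (le_antisymm (hle _) ?_)
      rw [htot]
      exact Finset.sum_le_sum fun ρ _ => min_le_right _ _)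
    (fun c _ => by
      rw [hstart]
      exact Nat.add_le_add_left (hle c) _)
  have h0 : ∀ ρ, Z ρ 0 = lo ρ := fun ρ => by
    rw [hZ0]
    have := hf.lo_le_hi ρ
    simp [this]
  have hhi : ∀ ρ c, Z ρ c ≤ hi ρ := fun ρ c => (hZle ρ c).trans (min_le_right _ _)
  -- The entries are at most `hi ρ` and have the same total, so every row ends at `hi ρ` and each
  -- element lies on some strand.
  have hM : ∀ ρ < N, Z ρ l.length = hi ρ := fun ρ hρ =>
    (Finset.sum_eq_sum_iff_of_le fun ρ _ => hhi ρ l.length).1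
      (by rw [hZsum _ le_rfl, htot, hhisum]) ρ (Finset.mem_range.2 hρ)
  have hcard : ∀ c < l.length, (strand f Z c).card = l.getD c 0 := fun c hc => by
    have h1 := hf.card_strand hZ h0 hhi c
    rw [hZsum c hc.le, hZsum (c + 1) hc, hsucc] at h1
    omega
  have hpos : ∀ c < l.length, 0 < l.getD c 0 := fun c hc => by
    rw [List.getD_eq_getElem _ _ hc]
    refine μ.parts_pos ?_
    rw [← hlc]
    exact Multiset.mem_coe.2 (List.getElem_mem hc)
  -- Parts are positive, so strands are nonempty and an element determines its strand; hence equal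
  -- parts of `μ` do not collapse in the image.
  have hinj : Set.InjOn (strand f Z) (Finset.range l.length) := fun c hc c' _ h => by
    have hc := Finset.mem_range.1 (Finset.mem_coe.1 hc)
    obtain ⟨x, hx⟩ := Finset.card_pos.1 ((hpos c hc).trans_eq (hcard c hc).symm)
    have h1 := mem_strand.1 hx
    rw [h] at hx
    have h2 := mem_strand.1 hx
    exact hZ.step_unique h1.1 h1.2 h2.1 h2.2
  let π : Finpartition (Finset.univ : Finset P) := Finpartition.ofExistsUnique
    ((Finset.range l.length).image (strand f Z)) (fun _ _ => Finset.subset_univ _)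
    (fun x _ => by
      have hN := hf.lt_N x
      obtain ⟨c, hc, h1, h2⟩ := hZ.exists_step (M := l.length)
        ((h0 _).trans_le (hf.lo_le_fst x)) ((hf.fst_lt_hi x).trans_eq (hM _ hN).symm)
      refine ⟨strand f Z c, ⟨Finset.mem_image_of_mem _ (Finset.mem_range.2 hc),
        mem_strand.2 ⟨h1, h2⟩⟩, ?_⟩
      rintro s ⟨hs, hxs⟩
      obtain ⟨c', -, rfl⟩ := Finset.mem_image.1 hs
      have h3 := mem_strand.1 hxs
      rw [hZ.step_unique h1 h2 h3.1 h3.2])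
    (fun h => by
      obtain ⟨c, hc, h⟩ := Finset.mem_image.1 h
      have hc := Finset.mem_range.1 hc
      have h1 := hcard c hc
      have h2 := hpos c hc
      rw [h, Finset.card_empty] at h1
      omega)
  refine ⟨π, ?_, ?_⟩
  · intro s hs a ha b hb hab
    obtain ⟨c, -, rfl⟩ := Finset.mem_image.1 hs
    rcases le_total ((f a).1 + (f a).2) ((f b).1 + (f b).2) with h | h
    · exact hab.1 (hf.strand_comparable hZ ha hb h)
    · exact hab.2 (hf.strand_comparable hZ hb ha h)
  · refine Nat.Partition.ext ?_
    change ((Finset.range l.length).image (strand f Z)).val.map Finset.card = μ.parts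
    rw [Finset.image_val_of_injOn hinj, Multiset.map_map, ← hlc, Finset.range_val,
      Multiset.range, Multiset.map_coe]
    refine congrArg _ (List.ext_getElem (by simp) fun c h1 h2 => ?_)
    simp only [List.getElem_map, List.getElem_range, Function.comp_apply]
    rw [hcard c h2, List.getD_eq_getElem _ _ h2]

theorem isNicePoset [DecidableEq P] (hf : IsBand f N lo hi) : IsNicePoset P := fun _ hν μ hμν =>
  hf.hasStablePartition μ fun k hk => (hμν k hk).trans (hf.sumLargest_le hν k)

end IsBand

/-! ### The ordinal sum as a band. -/

/-- The chains and the grid in `p ⊕ (m × n) ⊕ q`, drawn in `ℕ × ℕ`: the lower chain runs along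
the first row up to the grid, and the upper chain continues the last row of the grid. -/
def ChainProdSum.coord (p m n q : ℕ) (x : ChainProdSum p m n q) : ℕ × ℕ :=
  Sum.elim (fun y : Fin p ⊕ₗ (Fin m × Fin n) =>
      Sum.elim (fun a : Fin p => ((0 : ℕ), (a : ℕ)))
        (fun b : Fin m × Fin n => ((b.1 : ℕ), p + (b.2 : ℕ))) (ofLex y))
    (fun c : Fin q => (m - 1, p + n + (c : ℕ))) (ofLex x)

theorem ChainProdSum.coord_le_iff (p m n q : ℕ) (x y : ChainProdSum p m n q) :
    coord p m n q x ≤ coord p m n q y ↔ x ≤ y := by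
  obtain ((a | ⟨i, j⟩) | c) := x <;> obtain ((a' | ⟨i', j'⟩) | c') := y
  · exact (Prod.mk_le_mk.trans (by simp)).trans
      (Sum.Lex.inl_le_inl_iff.trans Sum.Lex.inl_le_inl_iff).symm
  · refine iff_of_true (Prod.mk_le_mk.2 ?_) (Sum.Lex.inl_le_inl_iff.2 (Sum.Lex.inl_le_inr _ _))
    omega
  · refine iff_of_true (Prod.mk_le_mk.2 ?_) (Sum.Lex.inl_le_inr _ _)
    omega
  · refine iff_of_false (fun h => ?_)
      fun h => Sum.Lex.not_inr_le_inl (Sum.Lex.inl_le_inl_iff.1 h)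
    have := (Prod.mk_le_mk.1 h).2
    omega
  · refine Iff.trans ?_ (Sum.Lex.inl_le_inl_iff.trans Sum.Lex.inr_le_inr_iff).symm
    refine Prod.mk_le_mk.trans ?_
    rw [Prod.mk_le_mk, Fin.le_def, Fin.le_def]
    exact and_congr_right' (Nat.add_le_add_iff_left)
  · refine iff_of_true (Prod.mk_le_mk.2 ?_) (Sum.Lex.inl_le_inr _ _)
    omega
  · refine iff_of_false (fun h => ?_) Sum.Lex.not_inr_le_inl
    have := (Prod.mk_le_mk.1 h).2
    omega
  · refine iff_of_false (fun h => ?_) Sum.Lex.not_inr_le_inl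
    have := (Prod.mk_le_mk.1 h).2
    omega
  · refine Iff.trans ?_ Sum.Lex.inr_le_inr_iff.symm
    refine Prod.mk_le_mk.trans ?_
    rw [Fin.le_def]
    omega

/-- The drawing of `p ⊕ (m × n) ⊕ q` in `ℕ × ℕ`. -/
def ChainProdSum.embedding (p m n q : ℕ) : ChainProdSum p m n q ↪o ℕ × ℕ :=
  OrderEmbedding.ofMapLEIff (coord p m n q) (coord_le_iff p m n q)

theorem ChainProdSum.isDistribLatticeOrder (p m n q : ℕ) :
    IsDistribLatticeOrder (ChainProdSum p m n q) :=
  ⟨inferInstance, rfl⟩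

/-- In the grid, `i` is bounded by `0 ≤ i < m` and `0 ≤ ρ - p - i < n`. Truncated subtraction gives
the interval `{0}` on the levels of the lower chain, and the minima give `{m - 1}` on those of the
upper chain, which start at `p + m + n - 1`. -/
theorem ChainProdSum.isBand (p m n q : ℕ) (hm : 1 ≤ m) (hn : 1 ≤ n) :
    IsBand (embedding p m n q) (p + m + n - 1 + q) (fun ρ => min (m - 1) (ρ - (p + n - 1)))
      (fun ρ => min m (ρ - p + 1)) where
  lo_le ρ := by omega
  le_lo ρ := by omega
  hi_le ρ := by omega
  le_hi ρ := by omega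
  lo_le_hi ρ := by omega
  lt_N x := by
    obtain ((a | ⟨i, j⟩) | c) := x
    · change 0 + (a : ℕ) < _
      omega
    · change (i : ℕ) + (p + j) < _
      omega
    · change m - 1 + (p + n + c) < _
      omega
  lo_le_fst x := by
    obtain ((a | ⟨i, j⟩) | c) := x
    · change min (m - 1) (0 + (a : ℕ) - (p + n - 1)) ≤ 0
      omega
    · change min (m - 1) ((i : ℕ) + (p + j) - (p + n - 1)) ≤ i
      omega
    · exact min_le_left _ _
  fst_lt_hi x := by
    obtain ((a | ⟨i, j⟩) | c) := x
    · change 0 < min m (0 + (a : ℕ) - p + 1)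
      omega
    · change (i : ℕ) < min m (i + (p + j) - p + 1)
      omega
    · change m - 1 < min m (m - 1 + (p + n + c) - p + 1)
      omega
  exists_eq ρ hρ i h1 h2 := by
    by_cases hp : ρ < p
    · refine ⟨toLex (Sum.inl (toLex (Sum.inl ⟨ρ, hp⟩))), ?_, ?_⟩
      · change 0 + ρ = ρ
        omega
      · change 0 = i
        omega
    by_cases hq : ρ < p + m + n - 1
    · refine ⟨toLex (Sum.inl (toLex (Sum.inr (⟨i, by omega⟩, ⟨ρ - p - i, by omega⟩)))), ?_, rfl⟩
      change i + (p + (ρ - p - i)) = ρ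
      omega
    · refine ⟨toLex (Sum.inr ⟨ρ - (p + m + n - 1), by omega⟩), ?_, ?_⟩
      · change m - 1 + (p + n + (ρ - (p + m + n - 1))) = ρ
        omega
      · change m - 1 = i
        omega

theorem mainTheorem4 (p q m n : ℕ) (hm : 1 ≤ m) (hn : 1 ≤ n) :
    IsDistribLatticeOrder (ChainProdSum p m n q) ∧ IsNicePoset (ChainProdSum p m n q) :=
  ⟨ChainProdSum.isDistribLatticeOrder p m n q, (ChainProdSum.isBand p m n q hm hn).isNicePoset⟩
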